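/- Let $N\in\mathbb N$ and let $\|\cdot\|$ be any norm on $\mathbb R^N$. Inequalities between vectors are coordinate-wise. On a probability space let $\{\boldsymbol R_i^{n}(x),\,x\ge 0\}$, $i=1,\dots,N$, $n\ge 1$, be mutually independent $N$-dimensional Lévy subordinators (Lévy processes started at $\boldsymbol 0$ whose paths are a.s. non-decreasing in every coordinate) such that, for each $i$, the processes $\boldsymbol R_i^{n}$, $n\ge1$, have the same law, with Laplace exponent $\kappa_i$: $$\mathbb E e^{-\boldsymbol u\cdot\boldsymbol R_i^n(x)}=e^{-x\kappa_i(\boldsymbol u)},\qquad x\ge 0,\ \boldsymbol u\ge\boldsymbol 0 .$$ Let $\boldsymbol G^n$, $n\ge 1$, be i.i.d. random vectors in $\mathbb R_+^N$, distributed as $\boldsymbol G=(G_1,\dots,G_N)$, with Laplace–Stieltjes transform (LST) $\tilde{\boldsymbol G}(\boldsymbol u)=\mathbb E e^{-\boldsymbol u\cdot \boldsymbol G}$. Let $\boldsymbol X=(\boldsymbol X^n)_{n\ge0}$ be a multi-type Jiřina branching process with branching mechanism $\boldsymbol\kappa=(\kappa_1,\dots,\kappa_N)$ and immigration $\boldsymbol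 G$, that is, $\boldsymbol X^0$ is a given random vector in $\mathbb R_+^N$ and $$\boldsymbol X^{n+1}=\sum_{i=1}^N \boldsymbol R_i^{n+1}(X_i^n)+\boldsymbol G^{n+1},\qquad n\ge 0,$$ where, for every $n\ge0$, the history $(\boldsymbol X^0,\dots,\boldsymbol X^n)$, the family $(\boldsymbol R_i^{n+1})_{i\le N}$ and the vector $\boldsymbol G^{n+1}$ are mutually independent. Assume that the mean matrix $M=(m_{i,j})$, $m_{i,j}=\mathbb E R_{i,j}^1(1)$, has finite entries, where $R_{i,j}^1$ is the $j$-th coordinate of $\boldsymbol R_i^1$; let $\rho_M$ be its spectral radius (its Perron–Frobenius eigenvalue). Put $\boldsymbol\kappa^{(0)}(\boldsymbol u)=\boldsymbol u$ and $\boldsymbol\kappa^{(k)}(\boldsymbol u)=\boldsymbol\kappa^{(k-1)}(\boldsymbol\kappa(\boldsymbol u))$ for $k\ge 1$. If $\|\boldsymbol G\|$ is integrable, then the following holds. 1. (Subcritical case.) If $\rho_M<1$, then $\boldsymbol X^n$ converges in distribution, as $n\to\infty$, to a random vector $\boldsymbol X^\infty$ in $\mathbb R_+^N$ satisfying $$\mathbb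 E e^{-\boldsymbol u\cdot\boldsymbol X^\infty}=\prod_{k=0}^\infty\tilde{\boldsymbol G}\bigl(\boldsymbol\kappa^{(k)}(\boldsymbol u)\bigr),\qquad \boldsymbol u\ge\boldsymbol 0,$$ where the infinite product converges. 2. (Supercritical case.) If $\rho_M>1$ and $\mathbb P(G_i>0)>0$ for every $i=1,\dots,N$, then $\|\boldsymbol X^n\|\to\infty$ almost surely as $n\to\infty$. -/

import Mathlib

open MeasureTheory ProbabilityTheory Filter Topology
open scoped NNReal ENNReal

namespace Jirina

section Definitions

variable {Ω : Type*} [MeasurableSpace Ω] {N : ℕ}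

/-- An `N`-dimensional Lévy process on the probability space `(Ω, P)`, with time set `[0, ∞)`:
it starts at `0`, has independent and stationary increments, and its paths are almost surely
right-continuous with left limits. -/
structure IsLevyProcess (P : Measure Ω) (L : ℝ≥0 → Ω → (Fin N → ℝ)) : Prop where
  measurable : ∀ t, Measurable (L t)
  zero : ∀ᵐ ω ∂P, L 0 ω = 0
  indepIncrements : HasIndepIncrements L P
  stationaryIncrements : ∀ s t : ℝ≥0,
    IdentDistrib (fun ω => L (s + t) ω - L s ω) (L t) P P
  rightContinuous : ∀ᵐ ω ∂P, ∀ t : ℝ≥0,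
    ContinuousWithinAt (fun s => L s ω) (Set.Ici t) t
  leftLimits : ∀ᵐ ω ∂P, ∀ t : ℝ≥0, ∃ l : Fin N → ℝ,
    Tendsto (fun s => L s ω) (𝓝[<] t) (𝓝 l)

/-- An `N`-dimensional Lévy subordinator: a Lévy process whose sample paths are almost surely
non-decreasing in all coordinates. -/
structure IsSubordinator (P : Measure Ω) (L : ℝ≥0 → Ω → (Fin N → ℝ)) : Prop
    extends IsLevyProcess P L where
  monotone : ∀ᵐ ω ∂P, Monotone (fun t => L t ω)

/-- The Laplace–Stieltjes transform `u ↦ E exp (-u ⋅ Y)` of a random vector `Y`. -/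
noncomputable def lst (P : Measure Ω) (Y : Ω → (Fin N → ℝ)) (u : Fin N → ℝ) : ℝ :=
  ∫ ω, Real.exp (-(u ⬝ᵥ Y ω)) ∂P

/-- The Laplace exponent `φ` of a process `L`, normalized by `E exp (-u ⋅ L 1) = exp (-φ u)`.
For a Lévy subordinator it satisfies `E exp (-u ⋅ L t) = exp (-t φ u)` for all `t ≥ 0` and
`u ≥ 0`; see `IsSubordinator.lst_eq`. -/
noncomputable def laplaceExponent (P : Measure Ω) (L : ℝ≥0 → Ω → (Fin N → ℝ))
    (u : Fin N → ℝ) : ℝ :=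
  -Real.log (lst P (L 1) u)

/-- `X` is a multi-type Jiřina branching process with immigration on `(Ω, P)`.  Here `R i n` is
the subordinator describing the offspring of type `i` parents in the step from time `n` to time
`n + 1`, and `G n` is the immigration in that step. -/
structure IsMTJBP (P : Measure Ω) (R : Fin N → ℕ → ℝ≥0 → Ω → (Fin N → ℝ))
    (G : ℕ → Ω → (Fin N → ℝ)) (X : ℕ → Ω → (Fin N → ℝ)) : Prop where
  /-- Every offspring process is a Lévy subordinator. -/
  subordinator : ∀ i n, IsSubordinator P (R i n)
  /-- The offspring processes of a given type have the same law in every step. -/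
  identDistrib_R : ∀ i n,
    IdentDistrib (fun ω t => R i n t ω) (fun ω t => R i 0 t ω) P P
  /-- All offspring processes are mutually independent. -/
  iIndepFun_R : iIndepFun (fun (p : Fin N × ℕ) ω (t : ℝ≥0) => R p.1 p.2 t ω) P
  /-- The immigration vectors are non-negative, i.i.d. random vectors. -/
  measurable_G : ∀ n, Measurable (G n)
  nonneg_G : ∀ n, ∀ᵐ ω ∂P, 0 ≤ G n ω
  identDistrib_G : ∀ n, IdentDistrib (G n) (G 0) P P
  iIndepFun_G : iIndepFun G P
  /-- `X` is a sequence of random vectors with a given non-negative initial vector. -/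
  measurable_X : ∀ n, Measurable (X n)
  nonneg_X_zero : ∀ᵐ ω ∂P, 0 ≤ X 0 ω
  /-- The one-step evolution.  The truncation `Real.toNNReal` only converts the almost surely
  non-negative number `X n ω i` into an element of the time set. -/
  evolution : ∀ n, ∀ᵐ ω ∂P, X (n + 1) ω = ∑ i, R i n (X n ω i).toNNReal ω + G n ω
  /-- The offspring processes and the immigration of a step are independent of the history of
  `X` up to that step, and of each other. -/
  indepFun_past : ∀ n, IndepFun (fun ω (k : Fin (n + 1)) => X k ω)
    (fun ω => ((fun (i : Fin N) (t : ℝ≥0) => R i n t ω), G n ω)) P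
  indepFun_R_G : ∀ n, IndepFun (fun ω (i : Fin N) (t : ℝ≥0) => R i n t ω) (G n) P

/-- The branching mechanism `κ = (κ₁, …, κ_N)`: the Laplace exponents of the offspring
processes. -/
noncomputable def branchingMechanism (P : Measure Ω)
    (R : Fin N → ℕ → ℝ≥0 → Ω → (Fin N → ℝ)) (u : Fin N → ℝ) : Fin N → ℝ :=
  fun i => laplaceExponent P (R i 0) u

/-- The mean matrix: `m i j` is the expected quantity of type `j` offspring per unit quantity of
type `i` parents. -/
noncomputable def meanMatrix (P : Measure Ω)
    (R : Fin N → ℕ → ℝ≥0 → Ω → (Fin N → ℝ)) : Matrix (Fin N) (Fin N) ℝ :=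
  Matrix.of fun i j => ∫ ω, R i 0 1 ω j ∂P

/-- The spectral radius of a real square matrix: the largest modulus of a complex eigenvalue. -/
noncomputable def rho (M : Matrix (Fin N) (Fin N) ℝ) : ℝ≥0∞ :=
  spectralRadius ℂ (M.map (fun x : ℝ => (x : ℂ)))

end Definitions

section LaplaceExponent

variable {Ω : Type*} [MeasurableSpace Ω] {N : ℕ} {P : Measure Ω} [IsProbabilityMeasure P]
  {L : ℝ≥0 → Ω → (Fin N → ℝ)}

/-- The defining property of the Laplace exponent of a Lévy subordinator. -/
theorem IsSubordinator.lst_eq (hL : IsSubordinator P L) {u : Fin N → ℝ} (hu : 0 ≤ u)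
    (t : ℝ≥0) : lst P (L t) u = Real.exp (-(t * laplaceExponent P L u)) := by
  have hmeas (t : ℝ≥0) : Measurable fun ω => Real.exp (-(u ⬝ᵥ L t ω)) := by
    have := hL.measurable t
    unfold dotProduct
    fun_prop
  have hnn (t : ℝ≥0) : ∀ᵐ ω ∂P, 0 ≤ u ⬝ᵥ L t ω := by
    filter_upwards [hL.zero, hL.monotone] with ω h0 hm
    refine dotProduct_nonneg_of_nonneg hu ?_
    have := hm (zero_le (a := t))
    simpa [h0] using this
  have hint (t : ℝ≥0) : Integrable (fun ω => Real.exp (-(u ⬝ᵥ L t ω))) P := by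
    refine Integrable.of_bound (hmeas t).aestronglyMeasurable 1 ?_
    filter_upwards [hnn t] with ω h
    rw [Real.norm_eq_abs, Real.abs_exp]
    exact Real.exp_le_one_iff.2 (by linarith)
  have hpos (t : ℝ≥0) : 0 < lst P (L t) u := integral_exp_pos (hint t)
  have hadd (s t : ℝ≥0) : lst P (L (s + t)) u = lst P (L s) u * lst P (L t) u := by
    have hi : IndepFun (L s) (fun ω => L (s + t) ω - L s ω) P :=
      hL.indepIncrements.indepFun_eval_sub (zero_le (a := s)) (le_add_of_nonneg_right (zero_le))
        hL.zero
    have hg : Measurable fun x : Fin N → ℝ => Real.exp (-(u ⬝ᵥ x)) := by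
      unfold dotProduct
      fun_prop
    have h1 := (hi.comp hg hg).integral_fun_mul_eq_mul_integral
      (hmeas s).aestronglyMeasurable
      (hg.comp ((hL.measurable (s + t)).sub (hL.measurable s))).aestronglyMeasurable
    have h2 := ((hL.stationaryIncrements s t).comp hg).integral_eq
    simp only [Function.comp_apply] at h1 h2
    rw [h2] at h1
    rw [lst, lst, lst, ← h1]
    refine integral_congr_ae (Eventually.of_forall fun ω => ?_)
    simp only [dotProduct_sub, ← Real.exp_add]
    congr 1
    ring
  have hanti {s t : ℝ≥0} (h : s ≤ t) : lst P (L t) u ≤ lst P (L s) u := by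
    refine integral_mono_ae (hint t) (hint s) ?_
    filter_upwards [hL.monotone] with ω hm
    exact Real.exp_le_exp.2 (neg_le_neg (dotProduct_le_dotProduct_of_nonneg_left (hm h) hu))
  set g : ℝ≥0 → ℝ := fun t => -Real.log (lst P (L t) u) with hg
  have gadd (s t : ℝ≥0) : g (s + t) = g s + g t := by
    simp only [hg, hadd, Real.log_mul (hpos s).ne' (hpos t).ne']
    ring
  have gmono {s t : ℝ≥0} (h : s ≤ t) : g s ≤ g t :=
    neg_le_neg (Real.log_le_log (hpos t) (hanti h))
  have gzero : g 0 = 0 := by simpa using gadd 0 0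
  have gmul (n : ℕ) (t : ℝ≥0) : g (n * t) = n * g t := by
    induction n with
    | zero => simp [gzero]
    | succ k ih =>
      push_cast
      rw [add_mul, one_mul, gadd, ih]
      ring
  have gnat (n : ℕ) : g n = n * g 1 := by simpa using gmul n 1
  have g1 : 0 ≤ g 1 := by simpa [gzero] using gmono (zero_le (a := (1 : ℝ≥0)))
  have key (n : ℕ) : |(n : ℝ) * (g t - t * g 1)| ≤ g 1 := by
    have hl : ((⌊(n : ℝ≥0) * t⌋₊ : ℕ) : ℝ≥0) ≤ n * t := Nat.floor_le (zero_le)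
    have hr : (n : ℝ≥0) * t ≤ ((⌊(n : ℝ≥0) * t⌋₊ + 1 : ℕ) : ℝ≥0) := by
      exact_mod_cast (Nat.lt_floor_add_one ((n : ℝ≥0) * t)).le
    have e1 := gmono hl
    have e2 := gmono hr
    rw [gnat, gmul] at e1 e2
    have hl' : ((⌊(n : ℝ≥0) * t⌋₊ : ℕ) : ℝ) ≤ n * t := by exact_mod_cast hl
    have hr' : (n : ℝ) * t ≤ (⌊(n : ℝ≥0) * t⌋₊ : ℕ) + 1 := by exact_mod_cast hr
    push_cast at e2
    rw [abs_le]
    constructor <;> nlinarith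
  have hlin : g t = t * g 1 := by
    by_contra hne
    have hd : 0 < |g t - t * g 1| := abs_pos.2 (sub_ne_zero.2 hne)
    obtain ⟨n, hn⟩ := exists_nat_gt (g 1 / |g t - t * g 1|)
    have := key n
    rw [abs_mul, Nat.abs_cast] at this
    rw [div_lt_iff₀ hd] at hn
    linarith
  have : laplaceExponent P L u = g 1 := rfl
  rw [this, ← hlin]
  simp [hg, Real.exp_log (hpos t)]

end LaplaceExponent

end Jirina

/-! Everything is read off the Laplace–Stieltjes transforms. Conditioning on `X n` and using the
Laplace exponents of the independent subordinators gives E exp(-u·X_{n+1}) = G̃(u) E exp(-κ(u)·X_n)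
(`lst_succ`). Iterating, the transform of X_n is that of X_0 at κ^(n)(u), times the product of
G̃(κ^(k)(u)) over k < n (`lst_eq_mul_prod`).

Subcritical case. By Jensen κ(u) ≤ Mu, hence κ^(k)(u) ≤ M^k u, and Gelfand's formula makes M^k
summable. So the initial factor tends to 1 and the transforms converge to the infinite product. As G
is integrable, 1 - G̃(κ^(k)(u)) is bounded by a summable sequence linear in u; this controls the
transforms near 0 uniformly in n, which is tightness. A continuity theorem
(`exists_tendstoInDistribution_of_tendsto_lst`) concludes. X_0 has no assumed moments, so its factor
is handled only by continuity at 0.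

Supercritical case. The moduli of an eigenvector form w ≥ 0 with Mw > w on the support of w. As κ
has derivative M at 0, a small v = εw satisfies v ≤ κ(v) (`exists_le_branchingMechanism`).
Monotonicity keeps the orbit of v above v, so E exp(-v·X_n) ≤ G̃(v)^n with G̃(v) < 1. Summability of
these expectations forces v·X_n → ∞ almost surely. -/

namespace Jirina

/-! ### Estimates for Laplace–Stieltjes transforms of non-negative vectors. -/

section LaplaceTransform

variable {Ω : Type*} [MeasurableSpace Ω] {N : ℕ} {P : Measure Ω} {Y : Ω → (Fin N → ℝ)}
  {u v : Fin N → ℝ}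

theorem measurable_exp_neg_dotProduct (u : Fin N → ℝ) :
    Measurable fun x : Fin N → ℝ => Real.exp (-(u ⬝ᵥ x)) := by
  unfold dotProduct
  fun_prop

theorem exp_neg_dotProduct_le_one {x : Fin N → ℝ} (hu : 0 ≤ u) (hx : 0 ≤ x) :
    Real.exp (-(u ⬝ᵥ x)) ≤ 1 :=
  Real.exp_le_one_iff.2 (neg_nonpos.2 (dotProduct_nonneg_of_nonneg hu hx))

theorem lst_congr_identDistrib {Ω' : Type*} [MeasurableSpace Ω'] {P' : Measure Ω'}
    {Z : Ω' → (Fin N → ℝ)} (h : IdentDistrib Y Z P P') (u : Fin N → ℝ) :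
    lst P Y u = lst P' Z u :=
  (h.comp (measurable_exp_neg_dotProduct u)).integral_eq

theorem integral_dotProduct (hint : ∀ j, Integrable (fun ω => Y ω j) P) (u : Fin N → ℝ) :
    ∫ ω, u ⬝ᵥ Y ω ∂P = u ⬝ᵥ fun j => ∫ ω, Y ω j ∂P := by
  unfold dotProduct
  rw [integral_finsetSum _ fun j _ => (hint j).const_mul _]
  simp_rw [integral_const_mul]

theorem integrable_dotProduct (hint : ∀ j, Integrable (fun ω => Y ω j) P) (u : Fin N → ℝ) :
    Integrable (fun ω => u ⬝ᵥ Y ω) P :=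
  integrable_finsetSum _ fun j _ => (hint j).const_mul _

variable [IsProbabilityMeasure P]

theorem integrable_exp_neg_dotProduct (hY : Measurable Y) (h0 : ∀ᵐ ω ∂P, 0 ≤ Y ω) (hu : 0 ≤ u) :
    Integrable (fun ω => Real.exp (-(u ⬝ᵥ Y ω))) P := by
  refine Integrable.of_bound
    ((measurable_exp_neg_dotProduct u).comp hY).aestronglyMeasurable 1 ?_
  filter_upwards [h0] with ω h
  rw [Real.norm_eq_abs, Real.abs_exp]
  exact exp_neg_dotProduct_le_one hu h

theorem lst_pos (hY : Measurable Y) (h0 : ∀ᵐ ω ∂P, 0 ≤ Y ω) (hu : 0 ≤ u) : 0 < lst P Y u :=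
  integral_exp_pos (integrable_exp_neg_dotProduct hY h0 hu)

theorem lst_anti (hY : Measurable Y) (h0 : ∀ᵐ ω ∂P, 0 ≤ Y ω) (hu : 0 ≤ u) (huv : u ≤ v) :
    lst P Y v ≤ lst P Y u := by
  refine integral_mono_ae (integrable_exp_neg_dotProduct hY h0 (hu.trans huv))
    (integrable_exp_neg_dotProduct hY h0 hu) ?_
  filter_upwards [h0] with ω h
  exact Real.exp_le_exp.2 (neg_le_neg (dotProduct_le_dotProduct_of_nonneg_right huv h))

@[simp]
theorem lst_zero : lst P Y 0 = 1 := by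
  simp [lst]

theorem lst_le_one (hY : Measurable Y) (h0 : ∀ᵐ ω ∂P, 0 ≤ Y ω) (hu : 0 ≤ u) :
    lst P Y u ≤ 1 := by
  simpa using lst_anti hY h0 le_rfl hu

/-- Integrates 1 - exp(-t) ≤ t. Applied to the immigration, it turns bounds on κ^(k)(u) into bounds
on the factors of the product. -/
theorem one_sub_lst_le (hY : Measurable Y) (h0 : ∀ᵐ ω ∂P, 0 ≤ Y ω)
    (hint : ∀ j, Integrable (fun ω => Y ω j) P) (hu : 0 ≤ u) :
    1 - lst P Y u ≤ u ⬝ᵥ fun j => ∫ ω, Y ω j ∂P := by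
  rw [← integral_dotProduct hint, sub_le_iff_le_add, lst,
    ← integral_add (integrable_dotProduct hint u) (integrable_exp_neg_dotProduct hY h0 hu)]
  have : (1 : ℝ) = ∫ _, (1 : ℝ) ∂P := by simp
  rw [this]
  refine integral_mono (integrable_const _)
    ((integrable_dotProduct hint u).add (integrable_exp_neg_dotProduct hY h0 hu)) fun ω => ?_
  have := Real.add_one_le_exp (-(u ⬝ᵥ Y ω))
  linarith

/-- Jensen's inequality for the Laplace–Stieltjes transform. -/
theorem neg_log_lst_le (hY : Measurable Y) (h0 : ∀ᵐ ω ∂P, 0 ≤ Y ω)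
    (hint : ∀ j, Integrable (fun ω => Y ω j) P) (hu : 0 ≤ u) :
    -Real.log (lst P Y u) ≤ u ⬝ᵥ fun j => ∫ ω, Y ω j ∂P := by
  rw [← integral_dotProduct hint, neg_le, ← integral_neg]
  rw [Real.le_log_iff_exp_le (lst_pos hY h0 hu)]
  exact convexOn_exp.map_integral_le Real.continuous_exp.continuousOn isClosed_univ
    (by simp) (integrable_dotProduct hint u).neg (integrable_exp_neg_dotProduct hY h0 hu)

theorem one_sub_lst_le_neg_log_lst (hY : Measurable Y) (h0 : ∀ᵐ ω ∂P, 0 ≤ Y ω) (hu : 0 ≤ u) :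
    1 - lst P Y u ≤ -Real.log (lst P Y u) := by
  have := Real.log_le_sub_one_of_pos (lst_pos hY h0 hu)
  linarith

/-- The Laplace–Stieltjes transform is continuous at `0` along every direction. -/
theorem tendsto_lst_smul (hY : Measurable Y) (h0 : ∀ᵐ ω ∂P, 0 ≤ Y ω) (hu : 0 ≤ u) :
    Tendsto (fun ε : ℝ => lst P Y (ε • u)) (𝓝[>] 0) (𝓝 1) := by
  have : (1 : ℝ) = ∫ _, (1 : ℝ) ∂P := by simp
  rw [this]
  refine tendsto_integral_filter_of_dominated_convergence (fun _ => 1)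
    (Eventually.of_forall fun ε =>
      ((measurable_exp_neg_dotProduct (ε • u)).comp hY).aestronglyMeasurable) ?_
    (integrable_const _) ?_
  · filter_upwards [self_mem_nhdsWithin] with ε hε
    filter_upwards [h0] with ω h
    rw [Real.norm_eq_abs, Real.abs_exp]
    exact exp_neg_dotProduct_le_one (smul_nonneg (le_of_lt hε) hu) h
  · refine Eventually.of_forall fun ω => tendsto_nhdsWithin_of_tendsto_nhds ?_
    have hc : Continuous fun ε : ℝ => Real.exp (-((ε • u) ⬝ᵥ Y ω)) := by
      simp only [smul_dotProduct]
      fun_prop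
    simpa using hc.tendsto 0

/-- The right derivative at `0` of the Laplace–Stieltjes transform along a direction. -/
theorem tendsto_one_sub_lst_smul_div (hY : Measurable Y) (h0 : ∀ᵐ ω ∂P, 0 ≤ Y ω)
    (hint : ∀ j, Integrable (fun ω => Y ω j) P) (hu : 0 ≤ u) :
    Tendsto (fun ε : ℝ => (1 - lst P Y (ε • u)) / ε) (𝓝[>] 0)
      (𝓝 (u ⬝ᵥ fun j => ∫ ω, Y ω j ∂P)) := by
  rw [← integral_dotProduct hint]
  have key : ∀ᶠ ε : ℝ in 𝓝[>] 0, ∫ ω, (1 - Real.exp (-((ε • u) ⬝ᵥ Y ω))) / ε ∂P =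
      (1 - lst P Y (ε • u)) / ε := by
    filter_upwards [self_mem_nhdsWithin] with ε hε
    rw [integral_div, integral_sub (integrable_const _)
      (integrable_exp_neg_dotProduct hY h0 (smul_nonneg (le_of_lt hε) hu))]
    simp [lst]
  refine Tendsto.congr' key ?_
  refine tendsto_integral_filter_of_dominated_convergence (fun ω => u ⬝ᵥ Y ω)
    (Eventually.of_forall fun ε => ((measurable_const.sub
      ((measurable_exp_neg_dotProduct (ε • u)).comp hY)).div_const _).aestronglyMeasurable) ?_
    (integrable_dotProduct hint u) ?_
  · filter_upwards [self_mem_nhdsWithin] with ε hε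
    have hε : 0 < ε := hε
    filter_upwards [h0] with ω h
    have h1 := exp_neg_dotProduct_le_one (smul_nonneg hε.le hu) h
    rw [Real.norm_eq_abs, abs_of_nonneg (div_nonneg (sub_nonneg.2 h1) hε.le), div_le_iff₀ hε]
    have h2 := Real.add_one_le_exp (-((ε • u) ⬝ᵥ Y ω))
    simp only [smul_dotProduct, smul_eq_mul] at h2 ⊢
    linarith
  · refine Eventually.of_forall fun ω => ?_
    have hd : HasDerivAt (fun ε : ℝ => -Real.exp (-(ε * (u ⬝ᵥ Y ω)))) (u ⬝ᵥ Y ω) 0 := by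
      have := (((hasDerivAt_id (0 : ℝ)).mul_const (u ⬝ᵥ Y ω)).neg.exp).neg
      convert! this using 1
      simp
    have := hd.tendsto_slope_zero_right
    refine this.congr fun ε => ?_
    simp only [zero_add, zero_mul, neg_zero, Real.exp_zero, smul_dotProduct, smul_eq_mul,
      div_eq_inv_mul]
    ring

/-- Equality would make the non-negative variable 1 - exp(-u·Y) vanish almost surely. The strict
bound provides the geometric ratio in the supercritical case. -/
theorem lst_lt_one (hY : Measurable Y) (h0 : ∀ᵐ ω ∂P, 0 ≤ Y ω) (hu : 0 ≤ u) {i : Fin N}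
    (hui : 0 < u i) (hi : 0 < P {ω | 0 < Y ω i}) : lst P Y u < 1 := by
  refine lt_of_le_of_ne (lst_le_one hY h0 hu) fun h => ?_
  have hint := integrable_exp_neg_dotProduct hY h0 hu
  have hz : ∫ ω, (1 - Real.exp (-(u ⬝ᵥ Y ω))) ∂P = 0 := by
    rw [integral_sub (integrable_const _) hint]
    rw [lst] at h
    simp [h]
  have hnn : 0 ≤ᵐ[P] fun ω => 1 - Real.exp (-(u ⬝ᵥ Y ω)) := by
    filter_upwards [h0] with ω h
    exact sub_nonneg.2 (exp_neg_dotProduct_le_one hu h)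
  have hz := (integral_eq_zero_iff_of_nonneg_ae hnn ((integrable_const _).sub hint)).1 hz
  refine hi.ne' (measure_mono_null ?_ (ae_iff.1 (hz.and h0)))
  intro ω hω hc
  obtain ⟨h1, h2⟩ := hc
  have h3 : u i * Y ω i ≤ u ⬝ᵥ Y ω :=
    Finset.single_le_sum (f := fun j => u j * Y ω j)
      (fun j _ => mul_nonneg (hu j) (h2 j)) (Finset.mem_univ i)
  have h4 : 0 < u i * Y ω i := mul_pos hui hω
  have h5 : Real.exp (-(u ⬝ᵥ Y ω)) < 1 := Real.exp_lt_one_iff.2 (by linarith)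
  simp only [Pi.zero_apply] at h1
  linarith

/-- A Markov-type inequality for the Laplace–Stieltjes transform. -/
theorem measureReal_one_le_dotProduct_le (hY : Measurable Y) (h0 : ∀ᵐ ω ∂P, 0 ≤ Y ω)
    (hu : 0 ≤ u) :
    P.real {ω | 1 ≤ u ⬝ᵥ Y ω} ≤ 2 * (1 - lst P Y u) := by
  have hint := integrable_exp_neg_dotProduct hY h0 hu
  -- Markov's inequality for 1 - exp(-u·Y) at level 1/2; this level is reached when u·Y ≥ 1, because
  -- exp(-1) < 1/2.
  have h1 := mul_meas_ge_le_integral_of_nonneg (μ := P)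
    (f := fun ω => 1 - Real.exp (-(u ⬝ᵥ Y ω)))
    (by filter_upwards [h0] with ω h
        exact sub_nonneg.2 (exp_neg_dotProduct_le_one hu h))
    ((integrable_const _).sub hint) (1 / 2)
  rw [integral_sub (integrable_const _) hint] at h1
  have h2 : P.real {ω | 1 ≤ u ⬝ᵥ Y ω} ≤
      P.real {ω | 1 / 2 ≤ 1 - Real.exp (-(u ⬝ᵥ Y ω))} := by
    refine measureReal_mono fun ω hω => ?_
    have h3 : Real.exp (-(u ⬝ᵥ Y ω)) ≤ Real.exp (-1) :=
      Real.exp_le_exp.2 (neg_le_neg hω)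
    have h4 := Real.exp_neg_one_lt_half
    simp only [Set.mem_ofPred_eq]
    linarith
  simp only [integral_const, probReal_univ, smul_eq_mul, mul_one] at h1
  change _ ≤ 1 - lst P Y u at h1
  linarith

end LaplaceTransform

/-! ### Comparison of an arbitrary norm with the supremum norm. -/

section FiniteDimensionalNorm

variable {N : ℕ}

theorem continuous_seminorm_pi (p : Seminorm ℝ (Fin N → ℝ)) : Continuous p := by
  refine Seminorm.continuous_of_le (q := (∑ i, p (Pi.single i 1)).toNNReal •
    normSeminorm ℝ (Fin N → ℝ)) ?_ fun x => ?_
  · exact continuous_norm.const_smul (∑ i, p (Pi.single i 1)).toNNReal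
  · have h0 : 0 ≤ ∑ i, p (Pi.single i 1) := Finset.sum_nonneg fun i _ => apply_nonneg p _
    have hx : x = ∑ i, x i • (Pi.single i (1 : ℝ) : Fin N → ℝ) := pi_eq_sum_univ' x
    change p x ≤ ((∑ i, p (Pi.single i 1)).toNNReal : ℝ) * ‖x‖
    rw [Real.coe_toNNReal _ h0, Finset.sum_mul]
    conv_lhs => rw [hx]
    refine (Finset.le_sum_of_subadditive p (map_zero p).le (map_add_le_add p) _ _).trans (Finset.sum_le_sum fun i _ => ?_)
    rw [map_smul_eq_mul, mul_comm]
    exact mul_le_mul_of_nonneg_left (norm_le_pi_norm x i) (apply_nonneg p _)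

/-- A continuous definite seminorm has a positive minimum on the compact unit sphere; C is its
inverse. The sphere is empty when N = 0, which is treated apart. -/
theorem exists_norm_le_mul_seminorm (p : Seminorm ℝ (Fin N → ℝ)) (hp : ∀ x, p x = 0 → x = 0) :
    ∃ C : ℝ, 0 < C ∧ ∀ x, ‖x‖ ≤ C * p x := by
  rcases (Metric.sphere (0 : Fin N → ℝ) 1).eq_empty_or_nonempty with he | hne
  · refine ⟨1, one_pos, fun x => ?_⟩
    have hx : ‖x‖ = 0 := by
      by_contra h
      have : ‖x‖⁻¹ • x ∈ Metric.sphere (0 : Fin N → ℝ) 1 := by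
        simp [norm_smul, h]
      rw [he] at this
      exact this
    rw [hx]
    positivity
  · obtain ⟨y, hy, hmin⟩ := (isCompact_sphere (0 : Fin N → ℝ) 1).exists_isMinOn hne
      (continuous_seminorm_pi p).continuousOn
    have hy1 : ‖y‖ = 1 := by simpa using hy
    have hpy : 0 < p y := lt_of_le_of_ne (apply_nonneg p y) fun h => by
      rw [hp y h.symm] at hy1
      simp at hy1
    refine ⟨(p y)⁻¹, inv_pos.2 hpy, fun x => ?_⟩
    rcases eq_or_ne x 0 with rfl | hx
    · simp
    have hx' : 0 < ‖x‖ := norm_pos_iff.2 hx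
    have h1 : p y ≤ p (‖x‖⁻¹ • x) := hmin (by simp [norm_smul, hx'.ne'])
    rw [map_smul_eq_mul, norm_inv, norm_norm] at h1
    rw [inv_mul_eq_div, le_div_iff₀ hpy]
    have := mul_le_mul_of_nonneg_left h1 hx'.le
    rwa [mul_inv_cancel_left₀ hx'.ne'] at this

end FiniteDimensionalNorm

/-! ### Continuity theorem for multivariate Laplace transforms. -/

section ContinuityTheorem

open BoundedContinuousFunction

variable {N : ℕ}

/-- The inclusion of the non-negative orthant into `ℝ^N`. -/
def orthantCoe (x : Fin N → ℝ≥0) : Fin N → ℝ := fun j => x j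

theorem continuous_orthantCoe : Continuous (orthantCoe (N := N)) := by
  unfold orthantCoe
  fun_prop

theorem orthantCoe_nonneg (x : Fin N → ℝ≥0) : 0 ≤ orthantCoe x := fun j => (x j).2

/-- The functions `x ↦ exp (-u ⋅ x)` on the non-negative orthant, as a monoid homomorphism into the
bounded continuous functions. -/
noncomputable def expNegHom (N : ℕ) :
    Multiplicative (Fin N → ℝ≥0) →* ((Fin N → ℝ≥0) →ᵇ ℝ) where
  toFun u := BoundedContinuousFunction.ofNormedAddCommGroup
    (fun x => Real.exp (-(orthantCoe u.toAdd ⬝ᵥ orthantCoe x)))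
    (by unfold orthantCoe dotProduct; fun_prop) 1 fun x => by
      rw [Real.norm_eq_abs, Real.abs_exp]
      exact exp_neg_dotProduct_le_one (orthantCoe_nonneg _) (orthantCoe_nonneg _)
  map_one' := by
    ext x
    simp [orthantCoe, dotProduct]
  map_mul' u v := by
    ext x
    simp [orthantCoe, dotProduct, ← Real.exp_add, add_mul, Finset.sum_add_distrib, add_comm]

theorem expNegHom_apply (u : Multiplicative (Fin N → ℝ≥0)) (x : Fin N → ℝ≥0) :
    expNegHom N u x = Real.exp (-(orthantCoe u.toAdd ⬝ᵥ orthantCoe x)) := rfl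

/-- The algebra of functions on the non-negative orthant generated by `x ↦ exp (-u ⋅ x)`. -/
noncomputable def expNegAlgebra (N : ℕ) : StarSubalgebra ℝ ((Fin N → ℝ≥0) →ᵇ ℝ) where
  toSubalgebra := Algebra.adjoin ℝ (Set.range (expNegHom N))
  star_mem' := by
    intro a ha
    have : star a = a := by
      ext x
      simp
    rwa [this]

theorem expNegAlgebra_separatesPoints :
    ((expNegAlgebra N).map (toContinuousMapStarₐ ℝ)).SeparatesPoints := by
  intro x y hxy
  obtain ⟨i, hi⟩ := Function.ne_iff.1 hxy
  refine ⟨_, ⟨_, ⟨expNegHom N (Multiplicative.ofAdd (Pi.single i 1)),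
    Algebra.subset_adjoin ⟨_, rfl⟩, rfl⟩, rfl⟩, ?_⟩
  have h (z : Fin N → ℝ≥0) :
      orthantCoe (Pi.single i (1 : ℝ≥0)) ⬝ᵥ orthantCoe z = z i := by
    simp [orthantCoe, dotProduct, Pi.single_apply, apply_ite ((↑) : ℝ≥0 → ℝ)]
  change Real.exp (-(orthantCoe (Pi.single i (1 : ℝ≥0)) ⬝ᵥ orthantCoe x)) ≠
    Real.exp (-(orthantCoe (Pi.single i (1 : ℝ≥0)) ⬝ᵥ orthantCoe y))
  rw [h, h]
  intro he
  apply hi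
  have := Real.exp_injective he
  exact_mod_cast neg_injective this

/-- A product of exponentials is again an exponential, so the generated algebra is just their linear
span, and linearity of the integral suffices. -/
theorem tendsto_integral_of_mem_expNegAlgebra {ι : Type*} {l : Filter ι}
    {μ : ι → ProbabilityMeasure (Fin N → ℝ≥0)} {μ₀ : ProbabilityMeasure (Fin N → ℝ≥0)}
    (h : ∀ u, Tendsto (fun n => ∫ x, expNegHom N u x ∂(μ n : Measure (Fin N → ℝ≥0))) l
      (𝓝 (∫ x, expNegHom N u x ∂(μ₀ : Measure (Fin N → ℝ≥0)))))
    {g : (Fin N → ℝ≥0) →ᵇ ℝ} (hg : g ∈ expNegAlgebra N) :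
    Tendsto (fun n => ∫ x, g x ∂(μ n : Measure (Fin N → ℝ≥0))) l
      (𝓝 (∫ x, g x ∂(μ₀ : Measure (Fin N → ℝ≥0)))) := by
  have hg' : g ∈ Submodule.span ℝ (Set.range (expNegHom N)) := by
    have h1 : g ∈ Subalgebra.toSubmodule (Algebra.adjoin ℝ (Set.range (expNegHom N))) := hg
    rwa [Algebra.adjoin_eq_span, ← MonoidHom.coe_mrange, Submonoid.closure_eq] at h1
  clear hg
  induction hg' using Submodule.span_induction with
  | mem x hx =>
    obtain ⟨u, rfl⟩ := hx
    exact h u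
  | zero => simpa using tendsto_const_nhds
  | add x y _ _ hx hy =>
    have e (ν : ProbabilityMeasure (Fin N → ℝ≥0)) :
        ∫ z, (x + y) z ∂(ν : Measure (Fin N → ℝ≥0)) =
          ∫ z, x z ∂(ν : Measure (Fin N → ℝ≥0)) + ∫ z, y z ∂(ν : Measure (Fin N → ℝ≥0)) :=
      integral_add (x.integrable _) (y.integrable _)
    simp_rw [e]
    exact hx.add hy
  | smul c x _ hx =>
    have e (ν : ProbabilityMeasure (Fin N → ℝ≥0)) :
        ∫ z, (c • x) z ∂(ν : Measure (Fin N → ℝ≥0)) =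
          c * ∫ z, x z ∂(ν : Measure (Fin N → ℝ≥0)) := by
      rw [← integral_const_mul]
      rfl
    simp_rw [e]
    exact hx.const_mul c

/-- A continuity theorem for Laplace–Stieltjes transforms of non-negative random vectors. -/
theorem exists_tendstoInDistribution_of_tendsto_lst {Ω : Type*} [MeasurableSpace Ω]
    {P : Measure Ω} [IsProbabilityMeasure P] {Y : ℕ → Ω → (Fin N → ℝ)}
    (hY : ∀ n, Measurable (Y n)) (h0 : ∀ n, ∀ᵐ ω ∂P, 0 ≤ Y n ω)
    (htight : ∀ δ : ℝ, 0 < δ → ∃ ε : ℝ, 0 < ε ∧ ∀ n, 1 - δ ≤ lst P (Y n) (fun _ => ε))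
    {φ : (Fin N → ℝ) → ℝ}
    (hφ : ∀ u : Fin N → ℝ, 0 ≤ u → Tendsto (fun n => lst P (Y n) u) atTop (𝓝 (φ u))) :
    ∃ (Ω' : Type) (_ : MeasurableSpace Ω') (P' : Measure Ω') (_ : IsProbabilityMeasure P')
      (Z : Ω' → (Fin N → ℝ)),
      (∀ ω, 0 ≤ Z ω) ∧ TendstoInDistribution Y atTop Z (fun _ => P) P' ∧
      ∀ u : Fin N → ℝ, 0 ≤ u → lst P' Z u = φ u := by
  -- The laws are moved to the orthant, where the functions exp(-u·x) are bounded; `W n` agrees with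
  -- `Y n` almost surely.
  set W : ℕ → Ω → (Fin N → ℝ≥0) := fun n ω j => (Y n ω j).toNNReal with hW
  have hWm (n : ℕ) : Measurable (W n) := by
    have := hY n
    fun_prop
  have hWY (n : ℕ) : (orthantCoe ∘ W n) =ᵐ[P] Y n := by
    filter_upwards [h0 n] with ω h
    ext j
    simpa [orthantCoe, hW] using h j
  let μ : ℕ → ProbabilityMeasure (Fin N → ℝ≥0) := fun n =>
    ⟨P.map (W n), Measure.isProbabilityMeasure_map (hWm n).aemeasurable⟩
  have hμ (n : ℕ) (u : Multiplicative (Fin N → ℝ≥0)) :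
      ∫ x, expNegHom N u x ∂(μ n : Measure (Fin N → ℝ≥0)) =
        lst P (Y n) (orthantCoe u.toAdd) := by
    change ∫ x, expNegHom N u x ∂(P.map (W n)) = _
    rw [integral_map (hWm n).aemeasurable (expNegHom N u).continuous.aestronglyMeasurable]
    refine integral_congr_ae ?_
    filter_upwards [hWY n] with ω h
    rw [expNegHom_apply, ← h]
    rfl
  have ht : IsTightMeasureSet {((ν : ProbabilityMeasure (Fin N → ℝ≥0)) :
      Measure (Fin N → ℝ≥0)) | ν ∈ Set.range μ} := by
    rw [isTightMeasureSet_iff_exists_isCompact_measure_compl_le]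
    intro ε hε
    obtain ⟨δ, hδ, hδε⟩ : ∃ δ : ℝ, 0 < δ ∧ ENNReal.ofReal (2 * δ) ≤ ε := by
      rcases eq_or_ne ε ∞ with rfl | hne
      · exact ⟨1, one_pos, le_top⟩
      · refine ⟨ε.toReal / 2, half_pos (ENNReal.toReal_pos hε.ne' hne), ?_⟩
        rw [mul_div_cancel₀ _ two_ne_zero, ENNReal.ofReal_toReal hne]
    obtain ⟨a, ha, hab⟩ := htight δ hδ
    -- Outside this ball some coordinate exceeds 1/a, so (a,…,a)·Y ≥ 1, and the Markov-type
    -- inequality bounds the probability by 2δ.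
    refine ⟨Metric.closedBall 0 a⁻¹, isCompact_closedBall _ _, ?_⟩
    rintro _ ⟨_, ⟨n, rfl⟩, rfl⟩
    change P.map (W n) _ ≤ ε
    rw [Measure.map_apply (hWm n) Metric.isClosed_closedBall.measurableSet.compl]
    refine le_trans ?_ hδε
    have hu : (0 : Fin N → ℝ) ≤ fun _ => a := fun _ => ha.le
    have hm : P (W n ⁻¹' (Metric.closedBall 0 a⁻¹)ᶜ) ≤
        P {ω | 1 ≤ (fun _ => a) ⬝ᵥ Y n ω} := by
      refine measure_mono_ae ?_
      filter_upwards [h0 n] with ω hω (h : W n ω ∈ (Metric.closedBall 0 a⁻¹)ᶜ)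
      change 1 ≤ (fun _ => a) ⬝ᵥ Y n ω
      simp only [Set.mem_compl_iff, Metric.mem_closedBall] at h
      rw [dist_pi_le_iff (by positivity)] at h
      push Not at h
      obtain ⟨j, hj⟩ := h
      have h1 : a⁻¹ < Y n ω j := by
        rw [NNReal.dist_eq] at hj
        have h2 : max (Y n ω j) 0 = Y n ω j := max_eq_left (hω j)
        simpa [hW, h2, abs_of_nonneg (hω j)] using hj
      have h2 : a * Y n ω j ≤ (fun _ => a) ⬝ᵥ Y n ω :=
        Finset.single_le_sum (f := fun j => a * Y n ω j)
          (fun j _ => mul_nonneg ha.le (hω j)) (Finset.mem_univ j)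
      rw [inv_lt_iff_one_lt_mul₀' ha] at h1
      exact h1.le.trans h2
    refine hm.trans ?_
    rw [← ofReal_measureReal]
    refine ENNReal.ofReal_le_ofReal
      ((measureReal_one_le_dotProduct_le (hY n) (h0 n) hu).trans ?_)
    linarith [hab n]
  have hcomp : IsCompact (closure (Set.range μ)) := isCompact_closure_of_isTightMeasureSet ht
  -- Tightness yields a limit along one ultrafilter finer than `atTop`. Its transform must be φ; the
  -- separating algebra then upgrades this to convergence of the whole sequence.
  obtain ⟨μ₀, -, hμ₀⟩ := hcomp.ultrafilter_le_nhds ((Ultrafilter.of atTop).map μ)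
    (by
      rw [le_principal_iff]
      exact Filter.mem_of_superset (Filter.mem_map.2 (Eventually.of_forall fun n => Set.mem_range_self n))
        subset_closure)
  have hμ₀' : Tendsto μ (↑(Ultrafilter.of (atTop : Filter ℕ))) (𝓝 μ₀) := hμ₀
  have hlim (u : Multiplicative (Fin N → ℝ≥0)) :
      ∫ x, expNegHom N u x ∂(μ₀ : Measure (Fin N → ℝ≥0)) = φ (orthantCoe u.toAdd) := by
    have h1 := (ProbabilityMeasure.tendsto_iff_forall_integral_tendsto.1 hμ₀') (expNegHom N u)
    simp_rw [hμ] at h1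
    exact tendsto_nhds_unique h1
      ((hφ _ (orthantCoe_nonneg _)).mono_left (Ultrafilter.of_le _))
  have hconv : Tendsto μ atTop (𝓝 μ₀) := by
    refine ProbabilityMeasure.tendsto_of_tight_of_separatesPoints ℝ (by simpa using ht)
      expNegAlgebra_separatesPoints fun g hg => tendsto_integral_of_mem_expNegAlgebra ?_ hg
    intro u
    rw [hlim]
    simp_rw [hμ]
    exact hφ _ (orthantCoe_nonneg _)
  have hWdist : TendstoInDistribution W atTop id (fun _ => P) (μ₀ : Measure (Fin N → ℝ≥0)) := by
    refine ⟨fun n => (hWm n).aemeasurable, aemeasurable_id, ?_⟩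
    simp only [Measure.map_id]
    exact hconv
  refine ⟨Fin N → ℝ≥0, inferInstance, μ₀, inferInstance, orthantCoe, orthantCoe_nonneg, ?_, ?_⟩
  · exact (hWdist.continuous_comp continuous_orthantCoe).congr hWY (by rfl)
  · intro u hu
    have h2 := hlim (Multiplicative.ofAdd fun j => (u j).toNNReal)
    have h3 : orthantCoe (fun j => (u j).toNNReal) = u := by
      ext j
      simpa [orthantCoe] using hu j
    rw [toAdd_ofAdd, h3] at h2
    rw [← h2, lst]
    refine integral_congr_ae (Eventually.of_forall fun x => ?_)
    simp only [expNegHom_apply, toAdd_ofAdd, h3]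

end ContinuityTheorem

/-! ### The one-step recursion for the transforms, and its iteration. -/

section Recursion

variable {Ω : Type*} [MeasurableSpace Ω] {N : ℕ} {P : Measure Ω} {u v : Fin N → ℝ}

theorem IsSubordinator.ae_nonneg {L : ℝ≥0 → Ω → (Fin N → ℝ)} (hL : IsSubordinator P L) :
    ∀ᵐ ω ∂P, ∀ t, 0 ≤ L t ω := by
  filter_upwards [hL.zero, hL.monotone] with ω h0 hm t
  have := hm (zero_le (a := t))
  simpa [h0] using this

/-- The smallest multiple of `1 / (m + 1)` which exceeds `y`. -/
noncomputable def gridAbove (m : ℕ) (y : ℝ≥0) : ℝ≥0 := (⌊(m + 1) * y⌋₊ + 1) / (m + 1)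

theorem le_gridAbove (m : ℕ) (y : ℝ≥0) : y ≤ gridAbove m y := by
  rw [gridAbove, le_div_iff₀ (by positivity), mul_comm]
  exact (Nat.lt_floor_add_one _).le

theorem gridAbove_le (m : ℕ) (y : ℝ≥0) : gridAbove m y ≤ y + 1 / (m + 1) := by
  rw [gridAbove, add_div]
  gcongr
  rw [div_le_iff₀ (by positivity), mul_comm y]
  exact Nat.floor_le zero_le

/-- Approximation from above is what right-continuity of the paths calls for. -/
theorem tendsto_gridAbove (y : ℝ≥0) :
    Tendsto (fun m => gridAbove m y) atTop (𝓝[Set.Ici y] y) := by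
  refine tendsto_nhdsWithin_iff.2 ⟨?_, Eventually.of_forall fun m => le_gridAbove m y⟩
  refine tendsto_of_tendsto_of_tendsto_of_le_of_le tendsto_const_nhds ?_
    (fun m => le_gridAbove m y) (fun m => gridAbove_le m y)
  have h : Tendsto (fun m : ℕ => 1 / ((m : ℝ≥0) + 1)) atTop (𝓝 0) := by
    rw [← NNReal.tendsto_coe]
    simpa using tendsto_one_div_add_atTop_nhds_zero_nat (𝕜 := ℝ)
  simpa using h.const_add y

/-- Evaluation (t, path) ↦ path(t) need not be jointly measurable for the product σ-algebra. After
rounding, the time takes countably many values and measurability is checked on each. -/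
theorem measurable_apply_gridAbove {E : Type*} [MeasurableSpace E] (m : ℕ) :
    Measurable fun p : ℝ≥0 × (ℝ≥0 → E) => p.2 (gridAbove m p.1) := by
  have h1 : Measurable fun q : ℕ × (ℝ≥0 → E) => q.2 ((q.1 + 1) / (m + 1)) :=
    measurable_from_prod_countable_right fun k =>
      measurable_pi_apply (((k : ℝ≥0) + 1) / ((m : ℝ≥0) + 1))
  have h2 : Measurable fun p : ℝ≥0 × (ℝ≥0 → E) => (⌊((m : ℝ≥0) + 1) * p.1⌋₊, p.2) :=
    (Nat.measurable_floor.comp (measurable_const.mul measurable_fst)).prodMk measurable_snd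
  exact h1.comp h2

variable {R : Fin N → ℕ → ℝ≥0 → Ω → (Fin N → ℝ)} {G X : ℕ → Ω → (Fin N → ℝ)}

theorem IsMTJBP.nonneg (hX : IsMTJBP P R G X) (n : ℕ) : ∀ᵐ ω ∂P, 0 ≤ X n ω := by
  induction n with
  | zero => exact hX.nonneg_X_zero
  | succ n ih =>
    filter_upwards [hX.evolution n, hX.nonneg_G n,
      ae_all_iff.2 fun i => (hX.subordinator i n).ae_nonneg] with ω h hG hR
    rw [h]
    exact add_nonneg (Finset.sum_nonneg fun i _ => hR i _) hG

theorem lst_G (hX : IsMTJBP P R G X) (n : ℕ) (u : Fin N → ℝ) : lst P (G n) u = lst P (G 0) u :=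
  lst_congr_identDistrib (hX.identDistrib_G n) u

theorem measurable_offspring (hX : IsMTJBP P R G X) (n : ℕ) :
    Measurable fun ω (i : Fin N) (t : ℝ≥0) => R i n t ω :=
  measurable_pi_lambda _ fun i => measurable_pi_lambda _ fun t => (hX.subordinator i n).measurable t

variable [IsProbabilityMeasure P]

theorem branchingMechanism_nonneg (hX : IsMTJBP P R G X) (hu : 0 ≤ u) :
    0 ≤ branchingMechanism P R u := fun i => by
  have hs := hX.subordinator i 0
  have h0 := hs.ae_nonneg.mono fun ω h => h 1
  exact neg_nonneg.2 (Real.log_nonpos (lst_pos (hs.measurable 1) h0 hu).le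
    (lst_le_one (hs.measurable 1) h0 hu))

theorem branchingMechanism_mono (hX : IsMTJBP P R G X) (hu : 0 ≤ u) (huv : u ≤ v) :
    branchingMechanism P R u ≤ branchingMechanism P R v := fun i => by
  have hs := hX.subordinator i 0
  have h0 := hs.ae_nonneg.mono fun ω h => h 1
  exact neg_le_neg (Real.log_le_log (lst_pos (hs.measurable 1) h0 (hu.trans huv))
    (lst_anti (hs.measurable 1) h0 hu huv))

theorem iterate_branchingMechanism_nonneg (hX : IsMTJBP P R G X) (hu : 0 ≤ u) (n : ℕ) :
    0 ≤ (branchingMechanism P R)^[n] u := by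
  induction n with
  | zero => simpa using hu
  | succ n ih =>
    rw [Function.iterate_succ_apply']
    exact branchingMechanism_nonneg hX ih

theorem lst_offspring (hX : IsMTJBP P R G X) (hu : 0 ≤ u) (i : Fin N) (n : ℕ) (t : ℝ≥0) :
    lst P (R i n t) u = Real.exp (-(t * branchingMechanism P R u i)) := by
  have h : IdentDistrib (R i n t) (R i 0 t) P P :=
    (hX.identDistrib_R i n).comp (measurable_pi_apply t)
  rw [lst_congr_identDistrib h, (hX.subordinator i 0).lst_eq hu]
  rfl

/-- The Laplace–Stieltjes transform of one step started from a deterministic state. -/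
theorem integral_step_const (hX : IsMTJBP P R G X) (hu : 0 ≤ u) (n : ℕ) (x : Fin N → ℝ≥0) :
    ∫ ω, Real.exp (-(u ⬝ᵥ ∑ i, R i n (x i) ω)) * Real.exp (-(u ⬝ᵥ G n ω)) ∂P =
      Real.exp (-(branchingMechanism P R u ⬝ᵥ fun i => (x i : ℝ))) * lst P (G 0) u := by
  have hRm (i : Fin N) : Measurable (R i n (x i)) := (hX.subordinator i n).measurable _
  have hg : Measurable fun r : Fin N → ℝ≥0 → Fin N → ℝ =>
      Real.exp (-(u ⬝ᵥ ∑ i, r i (x i))) :=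
    (measurable_exp_neg_dotProduct u).comp
      (Finset.measurable_sum _ fun i _ => (measurable_pi_apply (x i)).comp (measurable_pi_apply i))
  have h1 := ((hX.indepFun_R_G n).comp hg
    (measurable_exp_neg_dotProduct u)).integral_fun_mul_eq_mul_integral
    (hg.comp (measurable_offspring hX n)).aestronglyMeasurable
    ((measurable_exp_neg_dotProduct u).comp (hX.measurable_G n)).aestronglyMeasurable
  simp only [Function.comp_apply] at h1
  rw [h1, ← lst_G hX n u]
  congr 1
  have h2 : iIndepFun (fun (i : Fin N) ω (t : ℝ≥0) => R i n t ω) P :=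
    hX.iIndepFun_R.precomp (g := fun i : Fin N => (i, n)) fun i j h => (Prod.mk.inj h).1
  have h3 := (h2.comp (fun i (r : ℝ≥0 → Fin N → ℝ) => Real.exp (-(u ⬝ᵥ r (x i)))) fun i =>
    (measurable_exp_neg_dotProduct u).comp (measurable_pi_apply (x i))).integral_fun_prod_eq_prod_integral
    fun i => ((measurable_exp_neg_dotProduct u).comp (hRm i)).aestronglyMeasurable
  simp only [Function.comp_apply] at h3
  have h4 (ω : Ω) : Real.exp (-(u ⬝ᵥ ∑ i, R i n (x i) ω)) =
      ∏ i, Real.exp (-(u ⬝ᵥ R i n (x i) ω)) := by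
    rw [← Real.exp_sum, dotProduct_sum, Finset.sum_neg_distrib]
  simp_rw [h4]
  rw [h3]
  have h5 (i : Fin N) := lst_offspring hX hu i n (x i)
  simp only [lst] at h5
  simp_rw [h5]
  rw [← Real.exp_sum, Finset.sum_neg_distrib, dotProduct]
  simp_rw [mul_comm]

/-- The Laplace–Stieltjes transform of one step with the random times rounded up to a grid. -/
theorem integral_step_gridAbove (hX : IsMTJBP P R G X) (hu : 0 ≤ u) (n m : ℕ) :
    ∫ ω, Real.exp (-(u ⬝ᵥ ∑ i, R i n (gridAbove m (X n ω i).toNNReal) ω)) *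
        Real.exp (-(u ⬝ᵥ G n ω)) ∂P =
      (∫ ω, Real.exp (-(branchingMechanism P R u ⬝ᵥ
        fun i => (gridAbove m (X n ω i).toNNReal : ℝ))) ∂P) * lst P (G 0) u := by
  set S : Ω → (Fin N → ℝ≥0 → Fin N → ℝ) × (Fin N → ℝ) :=
    fun ω => (fun i t => R i n t ω, G n ω) with hS
  have hSm : Measurable S := (measurable_offspring hX n).prodMk (hX.measurable_G n)
  set F : (Fin N → ℝ) × ((Fin N → ℝ≥0 → Fin N → ℝ) × (Fin N → ℝ)) → ℝ := fun p =>
    Real.exp (-(u ⬝ᵥ ∑ i, p.2.1 i (gridAbove m (p.1 i).toNNReal))) *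
      Real.exp (-(u ⬝ᵥ p.2.2)) with hF
  have hFm : Measurable F := by
    refine ((measurable_exp_neg_dotProduct u).comp (Finset.measurable_sum _ fun i _ => ?_)).mul
      ((measurable_exp_neg_dotProduct u).comp (by fun_prop))
    exact (measurable_apply_gridAbove m).comp
      (f := fun p : (Fin N → ℝ) × ((Fin N → ℝ≥0 → Fin N → ℝ) × (Fin N → ℝ)) =>
        ((p.1 i).toNNReal, p.2.1 i)) (by fun_prop)
  have hXm := hX.measurable_X n
  have hind : IndepFun (X n) S P :=
    (hX.indepFun_past n).comp (φ := fun x : Fin (n + 1) → Fin N → ℝ => x (Fin.last n))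
      (ψ := id) (measurable_pi_apply _) measurable_id
  have hmap := (indepFun_iff_map_prod_eq_prod_map_map hXm.aemeasurable hSm.aemeasurable).1 hind
  have hpm : Measurable fun ω => (X n ω, S ω) := hXm.prodMk hSm
  have hbd : ∀ᵐ ω ∂P, ‖F (X n ω, S ω)‖ ≤ 1 := by
    filter_upwards [hX.nonneg_G n,
      ae_all_iff.2 fun i => (hX.subordinator i n).ae_nonneg] with ω hG hR
    rw [Real.norm_eq_abs, abs_of_nonneg (by positivity)]
    exact mul_le_one₀
      (exp_neg_dotProduct_le_one hu (Finset.sum_nonneg fun i _ => hR i _)) (Real.exp_pos _).le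
      (exp_neg_dotProduct_le_one hu hG)
  have hFi : Integrable F ((P.map (X n)).prod (P.map S)) := by
    rw [← hmap, integrable_map_measure hFm.aestronglyMeasurable hpm.aemeasurable]
    exact Integrable.of_bound (hFm.comp hpm).aestronglyMeasurable 1 hbd
  have h1 : ∫ ω, F (X n ω, S ω) ∂P = ∫ p, F p ∂((P.map (X n)).prod (P.map S)) := by
    rw [← hmap, integral_map hpm.aemeasurable hFm.aestronglyMeasurable]
  have := Measure.isProbabilityMeasure_map (μ := P) hXm.aemeasurable
  have := Measure.isProbabilityMeasure_map (μ := P) hSm.aemeasurable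
  change ∫ ω, F (X n ω, S ω) ∂P = _
  -- Fubini freezes the state `X n`, independent of the offspring and immigration of the step; the
  -- deterministic computation then applies.
  rw [h1, integral_prod _ hFi, integral_map hXm.aemeasurable
    hFm.stronglyMeasurable.integral_prod_right'.aestronglyMeasurable, ← integral_mul_const]
  refine integral_congr_ae (Eventually.of_forall fun ω => ?_)
  have hFX : Measurable fun y => F (X n ω, y) := hFm.comp measurable_prodMk_left
  simp only
  rw [integral_map hSm.aemeasurable hFX.aestronglyMeasurable]
  exact integral_step_const hX hu n fun i => gridAbove m (X n ω i).toNNReal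

/-- The one-step recursion for the Laplace–Stieltjes transforms. -/
theorem lst_succ (hX : IsMTJBP P R G X) (hu : 0 ≤ u) (n : ℕ) :
    lst P (X (n + 1)) u = lst P (X n) (branchingMechanism P R u) * lst P (G 0) u := by
  have hXm := hX.measurable_X n
  have hgm (m : ℕ) : Measurable (gridAbove m) := by
    unfold gridAbove
    exact ((measurable_from_nat (f := fun k : ℕ => (k : ℝ≥0))).comp
      (Nat.measurable_floor.comp (measurable_const.mul measurable_id))).add_const _ |>.div_const _
  have hκ := branchingMechanism_nonneg hX hu
  -- Both sides of the rounded identity pass to the limit by dominated convergence: this one through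
  -- right-continuity of the paths, the other through continuity of the exponential.
  have hL : Tendsto (fun m => ∫ ω, Real.exp (-(u ⬝ᵥ
      ∑ i, R i n (gridAbove m (X n ω i).toNNReal) ω)) * Real.exp (-(u ⬝ᵥ G n ω)) ∂P) atTop
      (𝓝 (lst P (X (n + 1)) u)) := by
    refine tendsto_integral_of_dominated_convergence (fun _ => 1) (fun m => ?_)
      (integrable_const _) (fun m => ?_) ?_
    · refine Measurable.aestronglyMeasurable ?_
      refine ((measurable_exp_neg_dotProduct u).comp (Finset.measurable_sum _ fun i _ => ?_)).mul
        ((measurable_exp_neg_dotProduct u).comp (hX.measurable_G n))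
      exact (measurable_apply_gridAbove m).comp
        (f := fun ω => ((X n ω i).toNNReal, fun t => R i n t ω))
        ((by fun_prop : Measurable fun ω => (X n ω i).toNNReal).prodMk
          (measurable_pi_lambda _ fun t => (hX.subordinator i n).measurable t))
    · filter_upwards [hX.nonneg_G n,
        ae_all_iff.2 fun i => (hX.subordinator i n).ae_nonneg] with ω hG hR
      rw [Real.norm_eq_abs, abs_of_nonneg (by positivity)]
      exact mul_le_one₀
        (exp_neg_dotProduct_le_one hu (Finset.sum_nonneg fun i _ => hR i _)) (Real.exp_pos _).le
        (exp_neg_dotProduct_le_one hu hG)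
    · filter_upwards [hX.evolution n,
        ae_all_iff.2 fun i => (hX.subordinator i n).rightContinuous] with ω hω hR
      have h1 : Tendsto (fun m => ∑ i, R i n (gridAbove m (X n ω i).toNNReal) ω) atTop
          (𝓝 (∑ i, R i n (X n ω i).toNNReal ω)) :=
        tendsto_finsetSum _ fun i _ => (hR i _).tendsto.comp (tendsto_gridAbove _)
      have hc : Continuous fun x : Fin N → ℝ => Real.exp (-(u ⬝ᵥ x)) := by
        unfold dotProduct
        fun_prop
      have h2 := ((hc.tendsto _).comp h1).mul_const (Real.exp (-(u ⬝ᵥ G n ω)))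
      rwa [← Real.exp_add, ← neg_add, ← dotProduct_add, ← hω] at h2
  have hR : Tendsto (fun m => (∫ ω, Real.exp (-(branchingMechanism P R u ⬝ᵥ
      fun i => (gridAbove m (X n ω i).toNNReal : ℝ))) ∂P) * lst P (G 0) u) atTop
      (𝓝 (lst P (X n) (branchingMechanism P R u) * lst P (G 0) u)) := by
    refine Tendsto.mul_const _ ?_
    refine tendsto_integral_of_dominated_convergence (fun _ => 1) (fun m => ?_)
      (integrable_const _) (fun m => ?_) ?_
    · refine Measurable.aestronglyMeasurable ((measurable_exp_neg_dotProduct _).comp ?_)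
      exact measurable_pi_lambda _ fun i =>
        measurable_coe_nnreal_real.comp ((hgm m).comp (by fun_prop))
    · refine Eventually.of_forall fun ω => ?_
      rw [Real.norm_eq_abs, Real.abs_exp]
      exact exp_neg_dotProduct_le_one hκ fun i => NNReal.coe_nonneg _
    · filter_upwards [hX.nonneg n] with ω hω
      have hc : Continuous fun x : Fin N → ℝ =>
          Real.exp (-(branchingMechanism P R u ⬝ᵥ x)) := by
        unfold dotProduct
        fun_prop
      refine (hc.tendsto _).comp (tendsto_pi_nhds.2 fun i => ?_)
      have h1 := (tendsto_gridAbove (X n ω i).toNNReal).mono_right nhdsWithin_le_nhds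
      rw [← NNReal.tendsto_coe, Real.coe_toNNReal _ (hω i)] at h1
      exact h1
  refine tendsto_nhds_unique hL (hR.congr fun m => ?_)
  rw [integral_step_gridAbove hX hu n m]

/-- The induction needs all u at once, because each step back replaces u by κ(u). -/
theorem lst_eq_mul_prod (hX : IsMTJBP P R G X) (n : ℕ) (hu : 0 ≤ u) :
    lst P (X n) u = lst P (X 0) ((branchingMechanism P R)^[n] u) *
      ∏ k ∈ Finset.range n, lst P (G 0) ((branchingMechanism P R)^[k] u) := by
  induction n generalizing u with
  | zero => simp
  | succ n ih =>
    rw [lst_succ hX hu n, ih (branchingMechanism_nonneg hX hu), Finset.prod_range_succ']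
    simp only [← Function.iterate_succ_apply, Function.iterate_zero, id_eq, mul_assoc]

end Recursion

/-! ### Consequences of ρ < 1 and of ρ > 1 for matrices. -/

section SpectralRadius

variable {N : ℕ}

-- Gelfand's formula: for ρ < r < 1 one has ‖A^n‖ ≤ r^n eventually, and the operator norm dominates
-- each entry.
open Matrix in
attribute [local instance] Matrix.linftyOpNormedRing Matrix.linftyOpNormedAlgebra in
theorem summable_pow_apply_of_rho_lt_one {M : Matrix (Fin N) (Fin N) ℝ} (h : rho M < 1)
    (i j : Fin N) : Summable fun k => (M ^ k) i j := by
  set A : Matrix (Fin N) (Fin N) ℂ := M.map (fun x : ℝ => (x : ℂ)) with hA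
  obtain ⟨r, hr, hr1⟩ := ENNReal.lt_iff_exists_nnreal_btwn.1 h
  have hr1 : r < 1 := by exact_mod_cast hr1
  have hg := spectrum.pow_nnnorm_pow_one_div_tendsto_nhds_spectralRadius A
  have hev : ∀ᶠ n : ℕ in atTop, ‖A ^ n‖ ≤ (r : ℝ) ^ n := by
    filter_upwards [hg.eventually_lt_const hr, eventually_gt_atTop 0] with n hn hn0
    have h1 : (‖A ^ n‖₊ : ℝ≥0∞) ≤ (r : ℝ≥0∞) ^ (n : ℝ) := by
      have := ENNReal.rpow_le_rpow hn.le (Nat.cast_nonneg (α := ℝ) n)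
      rwa [← ENNReal.rpow_mul, one_div_mul_cancel (by positivity), ENNReal.rpow_one] at this
    rw [ENNReal.rpow_natCast] at h1
    exact_mod_cast h1
  refine Summable.of_norm_bounded_eventually_nat
    (summable_geometric_of_lt_one r.2 (by exact_mod_cast hr1)) ?_
  filter_upwards [hev] with n hn
  refine le_trans ?_ hn
  have hpow : A ^ n = (M ^ n).map (fun x : ℝ => (x : ℂ)) :=
    (map_pow (Complex.ofRealHom.mapMatrix) M n).symm
  have h2 : ‖(M ^ n) i j‖ = ‖(A ^ n) i j‖ := by
    rw [hpow]
    simp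
  rw [h2, Matrix.linfty_opNorm_def, ← coe_nnnorm, NNReal.coe_le_coe]
  exact (Finset.single_le_sum (f := fun j => ‖(A ^ n) i j‖₊) (fun _ _ => zero_le)
    (Finset.mem_univ j)).trans
    (Finset.le_sup (f := fun i => ∑ j, ‖(A ^ n) i j‖₊) (Finset.mem_univ i))

/-- A non-negative matrix whose spectral radius exceeds `1` has a non-negative sub-invariant
vector. -/
theorem exists_lt_mulVec_of_one_lt_rho {M : Matrix (Fin N) (Fin N) ℝ} (hM : ∀ i j, 0 ≤ M i j)
    (h : 1 < rho M) :
    ∃ w : Fin N → ℝ, 0 ≤ w ∧ (∃ i, 0 < w i) ∧ ∀ i, 0 < w i → w i < M.mulVec w i := by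
  unfold rho spectralRadius at h
  simp only [lt_iSup_iff] at h
  obtain ⟨c, hc, h1⟩ := h
  have h1 : 1 < ‖c‖ := by exact_mod_cast h1
  rw [spectrum.mem_iff, Matrix.isUnit_iff_isUnit_det, isUnit_iff_ne_zero, not_not] at hc
  obtain ⟨z, hz, hz0⟩ := Matrix.exists_mulVec_eq_zero_iff.2 hc
  rw [Matrix.sub_mulVec, sub_eq_zero, Matrix.algebraMap_eq_diagonal] at hz0
  -- Triangle inequality in Mz = cz, where |c| > 1 and M has non-negative entries.
  have hle (i : Fin N) : ‖c‖ * ‖z i‖ ≤ M.mulVec (fun j => ‖z j‖) i := by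
    have h2 := congrFun hz0 i
    rw [Matrix.mulVec_diagonal] at h2
    simp only [Pi.algebraMap_apply, Algebra.algebraMap_self, RingHom.id_apply] at h2
    rw [← norm_mul, h2]
    change ‖∑ j, (M i j : ℂ) * z j‖ ≤ ∑ j, M i j * ‖z j‖
    refine (norm_sum_le _ _).trans (Finset.sum_le_sum fun j _ => ?_)
    simp [abs_of_nonneg (hM i j)]
  refine ⟨fun j => ‖z j‖, fun j => norm_nonneg _, ?_, fun i hi => ?_⟩
  · obtain ⟨i, hi⟩ := Function.ne_iff.1 hz
    exact ⟨i, norm_pos_iff.2 hi⟩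
  · refine lt_of_lt_of_le ?_ (hle i)
    exact lt_mul_of_one_lt_left hi h1

end SpectralRadius

/-! ### Subcritical case: domination by powers of M, and convergence in law. -/

section LongTime

variable {Ω : Type*} [MeasurableSpace Ω] {N : ℕ} {P : Measure Ω}
  {R : Fin N → ℕ → ℝ≥0 → Ω → (Fin N → ℝ)} {G X : ℕ → Ω → (Fin N → ℝ)} {u : Fin N → ℝ}

theorem integrable_apply_of_integrable_seminorm (p : Seminorm ℝ (Fin N → ℝ))
    (hp : ∀ x, p x = 0 → x = 0) {Y : Ω → (Fin N → ℝ)} (hY : Measurable Y)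
    (h : Integrable (fun ω => p (Y ω)) P) (j : Fin N) : Integrable (fun ω => Y ω j) P := by
  obtain ⟨C, -, hC⟩ := exists_norm_le_mul_seminorm p hp
  exact (h.const_mul C).mono' (by fun_prop)
    (Eventually.of_forall fun ω => (norm_le_pi_norm (Y ω) j).trans (hC _))

theorem meanMatrix_nonneg (hX : IsMTJBP P R G X) (i j : Fin N) : 0 ≤ meanMatrix P R i j :=
  integral_nonneg_of_ae ((hX.subordinator i 0).ae_nonneg.mono fun _ h => h 1 j)

theorem mulVec_mono_of_nonneg {M : Matrix (Fin N) (Fin N) ℝ} (hM : ∀ i j, 0 ≤ M i j)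
    {u v : Fin N → ℝ} (huv : u ≤ v) : M.mulVec u ≤ M.mulVec v :=
  fun i => dotProduct_le_dotProduct_of_nonneg_left huv fun j => hM i j

theorem one_sub_sum_le_prod {f : ℕ → ℝ} (h0 : ∀ k, 0 ≤ f k) (h1 : ∀ k, f k ≤ 1) (n : ℕ) :
    1 - ∑ k ∈ Finset.range n, (1 - f k) ≤ ∏ k ∈ Finset.range n, f k := by
  induction n with
  | zero => simp
  | succ n ih =>
    rw [Finset.sum_range_succ, Finset.prod_range_succ]
    have h2 : ∏ k ∈ Finset.range n, f k ≤ 1 :=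
      Finset.prod_le_one (fun k _ => h0 k) fun k _ => h1 k
    nlinarith [h0 n, h1 n, mul_nonneg (sub_nonneg.2 h2) (sub_nonneg.2 (h1 n))]

/-- Finite products decrease as the index set grows and are bounded below by 0. A zero limit is
allowed. -/
theorem multipliable_of_le_one {f : ℕ → ℝ} (h0 : ∀ k, 0 ≤ f k) (h1 : ∀ k, f k ≤ 1) :
    Multipliable f := by
  refine ⟨⨅ s : Finset ℕ, ∏ k ∈ s, f k, ?_⟩
  rw [HasProd, SummationFilter.unconditional_filter]
  refine tendsto_atTop_ciInf (Finset.prod_anti_set_of_le_one h0 h1) ⟨0, ?_⟩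
  rintro _ ⟨s, rfl⟩
  exact Finset.prod_nonneg fun k _ => h0 k

theorem summable_pow_mulVec_of_rho_lt_one {M : Matrix (Fin N) (Fin N) ℝ} (h : rho M < 1)
    (u : Fin N → ℝ) (i : Fin N) : Summable fun k => (M ^ k).mulVec u i := by
  simp only [Matrix.mulVec, dotProduct]
  exact summable_sum fun j _ => (summable_pow_apply_of_rho_lt_one h i j).mul_right (u j)

variable [IsProbabilityMeasure P]

theorem branchingMechanism_le_mulVec (hX : IsMTJBP P R G X)
    (hM : ∀ i j, Integrable (fun ω => R i 0 1 ω j) P) (hu : 0 ≤ u) :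
    branchingMechanism P R u ≤ (meanMatrix P R).mulVec u := fun i => by
  have hs := hX.subordinator i 0
  have h := neg_log_lst_le (hs.measurable 1) (hs.ae_nonneg.mono fun ω h => h 1) (hM i) hu
  rw [dotProduct_comm] at h
  exact h

theorem iterate_branchingMechanism_le_mulVec (hX : IsMTJBP P R G X)
    (hM : ∀ i j, Integrable (fun ω => R i 0 1 ω j) P) (hu : 0 ≤ u) (n : ℕ) :
    (branchingMechanism P R)^[n] u ≤ (meanMatrix P R ^ n).mulVec u := by
  induction n with
  | zero => simp
  | succ n ih =>
    rw [Function.iterate_succ_apply', pow_succ', ← Matrix.mulVec_mulVec]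
    exact (branchingMechanism_le_mulVec hX hM (iterate_branchingMechanism_nonneg hX hu n)).trans
      (mulVec_mono_of_nonneg (meanMatrix_nonneg hX) ih)

theorem pow_meanMatrix_mulVec_nonneg (hX : IsMTJBP P R G X)
    (hM : ∀ i j, Integrable (fun ω => R i 0 1 ω j) P) (hu : 0 ≤ u) (n : ℕ) :
    0 ≤ (meanMatrix P R ^ n).mulVec u :=
  (iterate_branchingMechanism_nonneg hX hu n).trans
    (iterate_branchingMechanism_le_mulVec hX hM hu n)

theorem lst_G_iterate_nonneg (hX : IsMTJBP P R G X) (hu : 0 ≤ u) (k : ℕ) :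
    0 ≤ lst P (G 0) ((branchingMechanism P R)^[k] u) :=
  (lst_pos (hX.measurable_G 0) (hX.nonneg_G 0) (iterate_branchingMechanism_nonneg hX hu k)).le

theorem lst_G_iterate_le_one (hX : IsMTJBP P R G X) (hu : 0 ≤ u) (k : ℕ) :
    lst P (G 0) ((branchingMechanism P R)^[k] u) ≤ 1 :=
  lst_le_one (hX.measurable_G 0) (hX.nonneg_G 0) (iterate_branchingMechanism_nonneg hX hu k)

theorem hasProd_lst_G_iterate (hX : IsMTJBP P R G X) (hu : 0 ≤ u) :
    HasProd (fun k => lst P (G 0) ((branchingMechanism P R)^[k] u))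
      (∏' k, lst P (G 0) ((branchingMechanism P R)^[k] u)) :=
  (multipliable_of_le_one (lst_G_iterate_nonneg hX hu) (lst_G_iterate_le_one hX hu)).hasProd

/-- In the subcritical case the contribution of the initial state to the Laplace–Stieltjes
transform of `X n` is uniformly close to `1` near the origin. -/
theorem exists_lst_smul_le_lst_iterate (hX : IsMTJBP P R G X)
    (hM : ∀ i j, Integrable (fun ω => R i 0 1 ω j) P) (hρ : rho (meanMatrix P R) < 1) :
    ∃ C : ℝ, 0 ≤ C ∧ ∀ ε : ℝ, 0 < ε → ∀ n, lst P (X 0) (ε • (C • (1 : Fin N → ℝ))) ≤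
      lst P (X 0) ((branchingMechanism P R)^[n] (ε • 1)) := by
  have hone : (0 : Fin N → ℝ) ≤ 1 := zero_le_one
  have hMn := pow_meanMatrix_mulVec_nonneg hX hM hone
  have hnn (i : Fin N) : 0 ≤ ∑' k, (meanMatrix P R ^ k).mulVec 1 i :=
    tsum_nonneg fun k => hMn k i
  -- Summing over all k and i gives a constant dominating every coordinate of every M^n 1.
  refine ⟨∑ i, ∑' k, (meanMatrix P R ^ k).mulVec 1 i,
    Finset.sum_nonneg fun i _ => hnn i, fun ε hε n => ?_⟩
  have hu : (0 : Fin N → ℝ) ≤ ε • 1 := smul_nonneg hε.le hone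
  refine lst_anti (hX.measurable_X 0) hX.nonneg_X_zero
    (iterate_branchingMechanism_nonneg hX hu n)
    ((iterate_branchingMechanism_le_mulVec hX hM hu n).trans ?_)
  rw [Matrix.mulVec_smul]
  refine smul_le_smul_of_nonneg_left (fun i => ?_) hε.le
  have h3 : (meanMatrix P R ^ n).mulVec 1 i ≤ ∑' k, (meanMatrix P R ^ k).mulVec 1 i :=
    (summable_pow_mulVec_of_rho_lt_one hρ 1 i).le_tsum n fun k _ => hMn k i
  have h4 := Finset.single_le_sum (f := fun i => ∑' k, (meanMatrix P R ^ k).mulVec 1 i)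
    (fun i _ => hnn i) (Finset.mem_univ i)
  rw [Pi.smul_apply, Pi.one_apply, smul_eq_mul, mul_one]
  exact h3.trans h4

/-- In the subcritical case the contribution of the immigration to the Laplace–Stieltjes
transform of `X n` is uniformly close to `1` near the origin. -/
theorem exists_one_sub_mul_le_prod (hX : IsMTJBP P R G X)
    (hM : ∀ i j, Integrable (fun ω => R i 0 1 ω j) P)
    (hG : ∀ j, Integrable (fun ω => G 0 ω j) P) (hρ : rho (meanMatrix P R) < 1) :
    ∃ C : ℝ, ∀ ε : ℝ, 0 < ε → ∀ n, 1 - ε * C ≤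
      ∏ k ∈ Finset.range n, lst P (G 0) ((branchingMechanism P R)^[k] (ε • 1)) := by
  have hone : (0 : Fin N → ℝ) ≤ 1 := zero_le_one
  obtain ⟨g, hg⟩ : ∃ g : Fin N → ℝ, g = fun j => ∫ ω, G 0 ω j ∂P := ⟨_, rfl⟩
  have hg0 : 0 ≤ g := fun j => by
    rw [hg]
    exact integral_nonneg_of_ae ((hX.nonneg_G 0).mono fun _ h => h j)
  have hsum : Summable fun k => (meanMatrix P R ^ k).mulVec 1 ⬝ᵥ g :=
    summable_sum fun j _ => (summable_pow_mulVec_of_rho_lt_one hρ 1 j).mul_right (g j)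
  refine ⟨∑' k, (meanMatrix P R ^ k).mulVec 1 ⬝ᵥ g, fun ε hε n => ?_⟩
  have hu : (0 : Fin N → ℝ) ≤ ε • 1 := smul_nonneg hε.le hone
  refine le_trans (sub_le_sub_left ?_ 1)
    (one_sub_sum_le_prod (lst_G_iterate_nonneg hX hu) (lst_G_iterate_le_one hX hu) n)
  calc ∑ k ∈ Finset.range n, (1 - lst P (G 0) ((branchingMechanism P R)^[k] (ε • 1)))
      ≤ ∑ k ∈ Finset.range n, ε * ((meanMatrix P R ^ k).mulVec 1 ⬝ᵥ g) := by
        refine Finset.sum_le_sum fun k _ => ?_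
        refine (one_sub_lst_le (hX.measurable_G 0) (hX.nonneg_G 0) hG
          (iterate_branchingMechanism_nonneg hX hu k)).trans ?_
        rw [← hg]
        refine (dotProduct_le_dotProduct_of_nonneg_right
          (iterate_branchingMechanism_le_mulVec hX hM hu k) hg0).trans ?_
        rw [Matrix.mulVec_smul, smul_dotProduct, smul_eq_mul]
    _ = ε * ∑ k ∈ Finset.range n, (meanMatrix P R ^ k).mulVec 1 ⬝ᵥ g := by
        rw [Finset.mul_sum]
    _ ≤ ε * ∑' k, (meanMatrix P R ^ k).mulVec 1 ⬝ᵥ g := by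
        refine mul_le_mul_of_nonneg_left ?_ hε.le
        exact hsum.sum_le_tsum _ fun k _ =>
          dotProduct_nonneg_of_nonneg (pow_meanMatrix_mulVec_nonneg hX hM hone k) hg0

/-- Uniform continuity at the origin of the Laplace–Stieltjes transforms of `X n`. -/
theorem exists_one_sub_le_lst (hX : IsMTJBP P R G X)
    (hM : ∀ i j, Integrable (fun ω => R i 0 1 ω j) P)
    (hG : ∀ j, Integrable (fun ω => G 0 ω j) P) (hρ : rho (meanMatrix P R) < 1)
    {δ : ℝ} (hδ : 0 < δ) : ∃ ε : ℝ, 0 < ε ∧ ∀ n, 1 - δ ≤ lst P (X n) (fun _ => ε) := by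
  have hone : (0 : Fin N → ℝ) ≤ 1 := zero_le_one
  obtain ⟨C', hC'0, ha⟩ := exists_lst_smul_le_lst_iterate hX hM hρ
  obtain ⟨C, hb⟩ := exists_one_sub_mul_le_prod hX hM hG hρ
  have hC'1 : (0 : Fin N → ℝ) ≤ C' • 1 := smul_nonneg hC'0 hone
  have hlim : Tendsto (fun ε : ℝ => lst P (X 0) (ε • (C' • (1 : Fin N → ℝ))) * (1 - ε * C))
      (𝓝[>] 0) (𝓝 1) := by
    have h2 : Tendsto (fun ε : ℝ => 1 - ε * C) (𝓝[>] 0) (𝓝 1) := by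
      have : Continuous fun ε : ℝ => 1 - ε * C := by fun_prop
      simpa using (this.tendsto 0).mono_left nhdsWithin_le_nhds
    simpa using (tendsto_lst_smul (hX.measurable_X 0) hX.nonneg_X_zero hC'1).mul h2
  obtain ⟨ε, hε, hε0⟩ := ((hlim.eventually_const_le (by linarith : 1 - δ < 1)).and
    self_mem_nhdsWithin).exists
  have hε0 : 0 < ε := hε0
  refine ⟨ε, hε0, fun n => hε.trans ?_⟩
  have hu : (0 : Fin N → ℝ) ≤ ε • 1 := smul_nonneg hε0.le hone
  have hu' : (fun _ => ε : Fin N → ℝ) = ε • 1 := by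
    ext
    simp
  rw [hu', lst_eq_mul_prod hX n hu]
  have hpos := lst_pos (hX.measurable_X 0) hX.nonneg_X_zero (smul_nonneg hε0.le hC'1)
  exact (mul_le_mul_of_nonneg_left (hb ε hε0 n) hpos.le).trans
    (mul_le_mul_of_nonneg_right (ha ε hε0 n)
      (Finset.prod_nonneg fun k _ => lst_G_iterate_nonneg hX hu k))

theorem tendsto_lst_of_rho_lt_one (hX : IsMTJBP P R G X)
    (hM : ∀ i j, Integrable (fun ω => R i 0 1 ω j) P) (hρ : rho (meanMatrix P R) < 1)
    (hu : 0 ≤ u) :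
    Tendsto (fun n => lst P (X n) u) atTop
      (𝓝 (∏' k, lst P (G 0) ((branchingMechanism P R)^[k] u))) := by
  have hMn := pow_meanMatrix_mulVec_nonneg hX hM hu
  -- The term 1/(n+1) keeps the scale strictly positive, as the right-hand limit at 0 requires.
  have hc : Tendsto (fun n : ℕ => ∑ i, (meanMatrix P R ^ n).mulVec u i + 1 / ((n : ℝ) + 1)) atTop
      (𝓝[>] 0) := by
    refine tendsto_nhdsWithin_iff.2 ⟨?_, Eventually.of_forall fun n => ?_⟩
    · have h1 : Tendsto (fun n => ∑ i, (meanMatrix P R ^ n).mulVec u i) atTop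
          (𝓝 (∑ _i : Fin N, 0)) :=
        tendsto_finsetSum _ fun i _ =>
          (summable_pow_mulVec_of_rho_lt_one hρ u i).tendsto_atTop_zero
      simpa using h1.add tendsto_one_div_add_atTop_nhds_zero_nat
    · exact add_pos_of_nonneg_of_pos (Finset.sum_nonneg fun i _ => hMn n i) (by positivity)
  have h1 : Tendsto (fun n => lst P (X 0) ((branchingMechanism P R)^[n] u)) atTop (𝓝 1) := by
    refine tendsto_of_tendsto_of_tendsto_of_le_of_le
      ((tendsto_lst_smul (hX.measurable_X 0) hX.nonneg_X_zero
        (zero_le_one : (0 : Fin N → ℝ) ≤ 1)).comp hc) tendsto_const_nhds (fun n => ?_)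
      fun n => lst_le_one (hX.measurable_X 0) hX.nonneg_X_zero
        (iterate_branchingMechanism_nonneg hX hu n)
    refine lst_anti (hX.measurable_X 0) hX.nonneg_X_zero
      (iterate_branchingMechanism_nonneg hX hu n)
      ((iterate_branchingMechanism_le_mulVec hX hM hu n).trans fun i => ?_)
    have h3 : (meanMatrix P R ^ n).mulVec u i ≤ ∑ i, (meanMatrix P R ^ n).mulVec u i :=
      Finset.single_le_sum (f := fun i => (meanMatrix P R ^ n).mulVec u i)
        (fun i _ => hMn n i) (Finset.mem_univ i)
    have h4 : (0 : ℝ) ≤ 1 / ((n : ℝ) + 1) := by positivity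
    simp only [Pi.smul_apply, Pi.one_apply, smul_eq_mul, mul_one]
    linarith
  have h2 := h1.mul (hasProd_lst_G_iterate hX hu).tendsto_prod_nat
  rw [one_mul] at h2
  exact h2.congr fun n => (lst_eq_mul_prod hX n hu).symm

theorem exists_tendstoInDistribution_of_rho_lt_one (hX : IsMTJBP P R G X)
    (hM : ∀ i j, Integrable (fun ω => R i 0 1 ω j) P)
    (hG : ∀ j, Integrable (fun ω => G 0 ω j) P) (hρ : rho (meanMatrix P R) < 1) :
    ∃ (Ω' : Type) (_ : MeasurableSpace Ω') (P' : Measure Ω') (_ : IsProbabilityMeasure P')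
      (Xlim : Ω' → (Fin N → ℝ)),
      (∀ ω, 0 ≤ Xlim ω) ∧ TendstoInDistribution X atTop Xlim (fun _ => P) P' ∧
      ∀ u : Fin N → ℝ, 0 ≤ u →
        HasProd (fun k : ℕ => lst P (G 0) ((branchingMechanism P R)^[k] u)) (lst P' Xlim u) := by
  obtain ⟨Ω', m', P', hP', Z, hZ0, hZ, hZl⟩ := exists_tendstoInDistribution_of_tendsto_lst
    hX.measurable_X hX.nonneg (fun δ hδ => exists_one_sub_le_lst hX hM hG hρ hδ)
    fun u hu => tendsto_lst_of_rho_lt_one hX hM hρ hu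
  refine ⟨Ω', m', P', hP', Z, hZ0, hZ, fun u hu => ?_⟩
  rw [hZl u hu]
  exact hasProd_lst_G_iterate hX hu

/-! ### Supercritical case: almost sure divergence. -/

theorem exists_le_branchingMechanism (hX : IsMTJBP P R G X)
    (hM : ∀ i j, Integrable (fun ω => R i 0 1 ω j) P) (hρ : 1 < rho (meanMatrix P R)) :
    ∃ v : Fin N → ℝ, 0 ≤ v ∧ (∃ i, 0 < v i) ∧ v ≤ branchingMechanism P R v := by
  obtain ⟨w, hw, ⟨i₀, hi₀⟩, hwM⟩ := exists_lt_mulVec_of_one_lt_rho (meanMatrix_nonneg hX) hρ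
  have hev : ∀ᶠ ε : ℝ in 𝓝[>] 0, ∀ i, (ε • w) i ≤ branchingMechanism P R (ε • w) i := by
    rw [eventually_all]
    intro i
    have hs := hX.subordinator i 0
    have hs0 := hs.ae_nonneg.mono fun ω h => h 1
    -- Where w vanishes, non-negativity of κ suffices. Elsewhere (1 - E exp(-εw·R_i(1)))/ε tends to
    -- (Mw)_i > w_i, and -log x ≥ 1 - x passes the bound to κ.
    rcases (hw i).eq_or_lt with hi | hi
    · filter_upwards [self_mem_nhdsWithin] with ε hε
      have hε : 0 < ε := hε
      have := branchingMechanism_nonneg hX (smul_nonneg hε.le hw) i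
      rw [Pi.smul_apply, ← hi]
      simpa using this
    · have hlt := hwM i hi
      have ht := tendsto_one_sub_lst_smul_div (hs.measurable 1) hs0 (hM i) hw
      rw [dotProduct_comm] at ht
      filter_upwards [ht.eventually_const_lt hlt, self_mem_nhdsWithin] with ε h1 hε
      have hε : 0 < ε := hε
      rw [lt_div_iff₀ hε] at h1
      have h2 := one_sub_lst_le_neg_log_lst (hs.measurable 1) hs0 (smul_nonneg hε.le hw)
      refine le_trans ?_ h2
      rw [Pi.smul_apply, smul_eq_mul, mul_comm]
      exact h1.le
  obtain ⟨ε, h1, hε⟩ := (hev.and self_mem_nhdsWithin).exists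
  have hε : 0 < ε := hε
  exact ⟨ε • w, smul_nonneg hε.le hw, ⟨i₀, mul_pos hε hi₀⟩, h1⟩

/-- By Tonelli the series of exp(-u·Y_n) has finite expectation, so it converges almost surely and
its terms tend to 0. No independence in n is needed. -/
theorem ae_tendsto_dotProduct_atTop {Y : ℕ → Ω → (Fin N → ℝ)} (hY : ∀ n, Measurable (Y n))
    (h0 : ∀ n, ∀ᵐ ω ∂P, 0 ≤ Y n ω) (hu : 0 ≤ u) (hs : Summable fun n => lst P (Y n) u) :
    ∀ᵐ ω ∂P, Tendsto (fun n => u ⬝ᵥ Y n ω) atTop atTop := by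
  have hm (n : ℕ) : Measurable fun ω => ENNReal.ofReal (Real.exp (-(u ⬝ᵥ Y n ω))) :=
    ENNReal.measurable_ofReal.comp ((measurable_exp_neg_dotProduct u).comp (hY n))
  have hfin : ∫⁻ ω, ∑' n, ENNReal.ofReal (Real.exp (-(u ⬝ᵥ Y n ω))) ∂P ≠ ∞ := by
    rw [lintegral_tsum fun n => (hm n).aemeasurable]
    have h1 (n : ℕ) : ∫⁻ ω, ENNReal.ofReal (Real.exp (-(u ⬝ᵥ Y n ω))) ∂P =
        ENNReal.ofReal (lst P (Y n) u) :=
      (ofReal_integral_eq_lintegral_ofReal (integrable_exp_neg_dotProduct (hY n) (h0 n) hu)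
        (Eventually.of_forall fun ω => (Real.exp_pos _).le)).symm
    simp_rw [h1]
    exact hs.tsum_ofReal_ne_top
  filter_upwards [ae_lt_top (Measurable.tsum hm) hfin] with ω hω
  have h1 := ENNReal.tendsto_atTop_zero_of_tsum_ne_top hω.ne
  have h2 := (ENNReal.tendsto_toReal ENNReal.zero_ne_top).comp h1
  have h3 : Tendsto (fun n => Real.exp (-(u ⬝ᵥ Y n ω))) atTop (𝓝 0) := by
    refine h2.congr fun n => ?_
    exact ENNReal.toReal_ofReal (Real.exp_pos _).le
  exact tendsto_neg_atBot_iff.1 (Real.tendsto_exp_comp_nhds_zero.1 h3)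

theorem ae_tendsto_seminorm_atTop_of_one_lt_rho (hX : IsMTJBP P R G X)
    (hM : ∀ i j, Integrable (fun ω => R i 0 1 ω j) P)
    (p : Seminorm ℝ (Fin N → ℝ)) (hp : ∀ x, p x = 0 → x = 0)
    (hρ : 1 < rho (meanMatrix P R)) (hG : ∀ i, 0 < P {ω | 0 < G 0 ω i}) :
    ∀ᵐ ω ∂P, Tendsto (fun n => p (X n ω)) atTop atTop := by
  obtain ⟨v, hv, ⟨i, hi⟩, hvκ⟩ := exists_le_branchingMechanism hX hM hρ
  have hGm := hX.measurable_G 0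
  have hG0 := hX.nonneg_G 0
  have hiter (k : ℕ) : v ≤ (branchingMechanism P R)^[k] v := by
    induction k with
    | zero => simp
    | succ k ih =>
      rw [Function.iterate_succ_apply']
      exact hvκ.trans (branchingMechanism_mono hX hv ih)
  have hle (n : ℕ) : lst P (X n) v ≤ lst P (G 0) v ^ n := by
    rw [lst_eq_mul_prod hX n hv]
    have h1 : ∏ k ∈ Finset.range n, lst P (G 0) ((branchingMechanism P R)^[k] v) ≤
        lst P (G 0) v ^ n := by
      refine (Finset.prod_le_prod (fun k _ => (lst_pos hGm hG0 (hv.trans (hiter k))).le)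
        fun k _ => lst_anti hGm hG0 hv (hiter k)).trans ?_
      simp
    refine (mul_le_of_le_one_left ?_ ?_).trans h1
    · exact Finset.prod_nonneg fun k _ => (lst_pos hGm hG0 (hv.trans (hiter k))).le
    · exact lst_le_one (hX.measurable_X 0) hX.nonneg_X_zero (hv.trans (hiter n))
  have hs : Summable fun n => lst P (X n) v :=
    Summable.of_nonneg_of_le (fun n => (lst_pos (hX.measurable_X n) (hX.nonneg n) hv).le) hle
      (summable_geometric_of_lt_one (lst_pos hGm hG0 hv).le
        (lst_lt_one hGm hG0 hv hi (hG i)))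
  obtain ⟨C, hC, hCp⟩ := exists_norm_le_mul_seminorm p hp
  have hsum : 0 < ∑ j, v j :=
    Finset.sum_pos' (fun j _ => hv j) ⟨i, Finset.mem_univ i, hi⟩
  filter_upwards [ae_tendsto_dotProduct_atTop hX.measurable_X hX.nonneg hv hs] with ω hω
  -- Each coordinate of X_n is at most C p(X_n), so v·X_n ≤ (Σ v_j) C p(X_n).
  refine (tendsto_const_mul_atTop_of_pos (mul_pos hsum hC)).1 (tendsto_atTop_mono (fun n => ?_) hω)
  rw [mul_assoc, Finset.sum_mul]
  refine Finset.sum_le_sum fun j _ => mul_le_mul_of_nonneg_left ?_ (hv j)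
  exact (le_abs_self _).trans ((norm_le_pi_norm (X n ω) j).trans (hCp _))

end LongTime

end Jirina

theorem theorem3p1 {N : ℕ} {Ω : Type*} [MeasurableSpace Ω] (P : Measure Ω)
    [IsProbabilityMeasure P]
    (R : Fin N → ℕ → ℝ≥0 → Ω → (Fin N → ℝ)) (G X : ℕ → Ω → (Fin N → ℝ))
    (hX : Jirina.IsMTJBP P R G X)
    -- the mean matrix is finite
    (hM : ∀ i j, Integrable (fun ω => R i 0 1 ω j) P)
    -- an arbitrary norm on `ℝ^N`
    (nrm : Seminorm ℝ (Fin N → ℝ)) (hnrm : ∀ x, nrm x = 0 → x = 0)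
    (hG : Integrable (fun ω => nrm (G 0 ω)) P) :
    (Jirina.rho (Jirina.meanMatrix P R) < 1 →
      ∃ (Ω' : Type) (_ : MeasurableSpace Ω') (P' : Measure Ω') (_ : IsProbabilityMeasure P')
        (Xlim : Ω' → (Fin N → ℝ)),
        (∀ ω, 0 ≤ Xlim ω) ∧
        TendstoInDistribution X atTop Xlim (fun _ => P) P' ∧
        ∀ u : Fin N → ℝ, 0 ≤ u →
          HasProd (fun k : ℕ => Jirina.lst P (G 0) ((Jirina.branchingMechanism P R)^[k] u))
            (Jirina.lst P' Xlim u)) ∧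
    (1 < Jirina.rho (Jirina.meanMatrix P R) → (∀ i, 0 < P {ω | 0 < G 0 ω i}) →
      ∀ᵐ ω ∂P, Tendsto (fun n => nrm (X n ω)) atTop atTop) :=
  ⟨Jirina.exists_tendstoInDistribution_of_rho_lt_one hX hM
    (Jirina.integrable_apply_of_integrable_seminorm nrm hnrm (hX.measurable_G 0) hG),
    Jirina.ae_tendsto_seminorm_atTop_of_one_lt_rho hX hM nrm hnrm⟩
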